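/- Let $k$ be a field, $n\ge 2$, $r\ge 3n+2$ and $s=r(3n+2)+3$. Let $\mathfrak{P}_{nr}\subset k[x_1,x_2,x_3,x_4]$ be the kernel of the $k$-algebra homomorphism $k[x_1,\dots,x_4]\to k[t]$ with $x_1\mapsto t^{s}$, $x_2\mapsto t^{s+3}$, $x_3\mapsto t^{s+3n+1}$, $x_4\mapsto t^{s+3n+2}$. Put $$f_1=x_2x_3^3-x_1x_4^3,\qquad f_{2i}=x_1^{n-i}x_3^{3i-1}-x_2^{n-i+1}x_4^{3i-2}\ (1\le i\le n),$$ $$f_{3j}=x_1^{r-n+3+j}x_2^{n-1-j}-x_3^{2+3j}x_4^{r-1-3j},\qquad f_{4j}=x_1^{r-2n+3+j}x_2^{2n-j}-x_3^{3j+1}x_4^{r+1-3j}\ (0\le j\le n-1),$$ $$f_5=x_1^{r-n+2}x_2^nx_3-x_4^{r+2},\quad f_6=x_2^{n+1}x_3-x_1^nx_4^2,\quad f_7=x_2^{2n+1}-x_1^{2n-1}x_3x_4,\quad g=x_1^{r+2}-x_2x_4^r,$$ and let $G_{nr}=\big(\{f_1,f_{2i},f_{3j},f_{4j},f_5,f_6,f_7\mid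 1\le i\le n,\ 0\le j\le n-1\}\setminus\{f_{3(n-1)}\}\big)\cup\{g\}$. Then, with respect to the degree reverse lexicographic order with $x_1>x_2>x_3>x_4$, the set $G_{nr}$ is a Gröbner basis of $\mathfrak{P}_{nr}$. Moreover, the unique minimal set of monomial generators of the initial ideal $\mathrm{in}_<(\mathfrak{P}_{nr})$ is $$\{x_2x_3^3,\ x_1^{n-i}x_3^{3i-1},\ x_1^{r-n+3+j}x_2^{n-1-j},\ x_1^{r-2n+3+j}x_2^{2n-j},\ x_1^{r-n+2}x_2^nx_3,\ x_2^{n+1}x_3,\ x_2^{2n+1}\mid 1\le i\le n,\ 0\le j\le n-1\},$$ and none of these monomials is divisible by $x_4$. -/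

import Mathlib

noncomputable section

namespace Backelin

open MvPolynomial

/-! ### Degree reverse lexicographic order -/

/-- Exponent vectors in `m` variables, to be ordered degree-reverse-lexicographically. -/
def DegRevLex (m : ℕ) : Type := Fin m →₀ ℕ

namespace DegRevLex

instance (m : ℕ) : AddCommMonoid (DegRevLex m) :=
  inferInstanceAs (AddCommMonoid (Fin m →₀ ℕ))

/-- The identity map, as an additive equivalence. -/
def toDRL (m : ℕ) : (Fin m →₀ ℕ) ≃+ DegRevLex m := AddEquiv.refl _

/-- The comparison key: first the total degree, then the reversed colexicographic order
of the exponents. See `DegRevLex.lt_iff` for the explicit form of the order. -/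
def key {m : ℕ} (a : DegRevLex m) : ℕ ×ₗ (Colex (Fin m → ℕ))ᵒᵈ :=
  toLex (((toDRL m).symm a).degree, OrderDual.toDual (toColex ⇑((toDRL m).symm a)))

theorem key_injective (m : ℕ) : Function.Injective (key (m := m)) := by
  intro a b h
  have h2 := congrArg (fun p => ofColex (OrderDual.ofDual (ofLex p).2)) h
  exact (toDRL m).symm.injective (DFunLike.coe_injective h2)

instance (m : ℕ) : LinearOrder (DegRevLex m) := LinearOrder.lift' key (key_injective m)

/-- `a < b` iff `deg a < deg b`, or the degrees agree and at the last index where `a` and `b`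
differ the entry of `a` is the larger one. In particular `x₀ > x₁ > ⋯`. -/
theorem lt_iff {m : ℕ} (a b : Fin m →₀ ℕ) :
    toDRL m a < toDRL m b ↔ a.degree < b.degree ∨
      (a.degree = b.degree ∧ ∃ i, (∀ j, i < j → a j = b j) ∧ b i < a i) := by
  have h : toDRL m a < toDRL m b ↔ key (toDRL m a) < key (toDRL m b) := Iff.rfl
  rw [h, key, key, Prod.Lex.toLex_lt_toLex]
  simp only [AddEquiv.symm_apply_apply, OrderDual.toDual_lt_toDual]
  refine or_congr Iff.rfl (and_congr Iff.rfl (exists_congr fun i => and_congr ?_ Iff.rfl))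
  exact forall_congr' fun j => imp_congr Iff.rfl eq_comm

theorem add_lt {m : ℕ} (a b c : Fin m →₀ ℕ) (h : toDRL m a < toDRL m b) :
    toDRL m (a + c) < toDRL m (b + c) := by
  rw [lt_iff] at h ⊢
  simpa using h

instance (m : ℕ) : IsOrderedAddMonoid (DegRevLex m) where
  add_le_add_left a b h c := by
    rcases h.eq_or_lt with rfl | h
    · exact le_rfl
    · exact (add_lt a b c h).le

theorem toDRL_monotone (m : ℕ) : Monotone (toDRL m) := by
  intro a b h
  rcases h.eq_or_lt with rfl | h
  · exact le_rfl
  · refine le_of_lt ((lt_iff a b).2 (Or.inl ?_))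
    obtain ⟨c, rfl⟩ := le_iff_exists_add.1 h.le
    have hc : c ≠ 0 := by
      rintro rfl
      simp at h
    have : c.degree ≠ 0 := fun h0 => hc ((Finsupp.degree_eq_zero_iff c).1 h0)
    rw [map_add]
    omega

instance (m : ℕ) : WellFoundedLT (DegRevLex m) := by
  have := (toDRL_monotone m).wellQuasiOrderedLE_of_wellQuasiOrderedLE_of_surjective (toDRL m).surjective
  infer_instance

end DegRevLex

/-- The degree reverse lexicographic order on `k[X 0, …, X (m-1)]` with
`X 0 > X 1 > ⋯ > X (m-1)`. -/
def degRevLex (m : ℕ) : MonomialOrder (Fin m) where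
  syn := DegRevLex m
  toSyn := DegRevLex.toDRL m
  toSyn_monotone := DegRevLex.toDRL_monotone m

/-! ### Initial ideals, Gröbner bases, minimal monomial generators -/

section

variable {σ k : Type*} [Field k]

/-- The leading monomials of the nonzero elements of a set of polynomials. -/
def leadMonomials (m : MonomialOrder σ) (F : Set (MvPolynomial σ k)) : Set (MvPolynomial σ k) :=
  {u | ∃ f ∈ F, f ≠ 0 ∧ u = monomial (m.degree f) 1}

/-- The initial ideal of `I`. -/
def initialIdeal (m : MonomialOrder σ) (I : Ideal (MvPolynomial σ k)) :
    Ideal (MvPolynomial σ k) :=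
  Ideal.span (leadMonomials m (I : Set (MvPolynomial σ k)))

/-- `G` is a Gröbner basis of `I`: a finite subset of `I` whose leading monomials generate
the initial ideal of `I`. -/
def IsGroebnerBasis (m : MonomialOrder σ) (G : Set (MvPolynomial σ k))
    (I : Ideal (MvPolynomial σ k)) : Prop :=
  G.Finite ∧ G ⊆ (I : Set (MvPolynomial σ k)) ∧
    Ideal.span (leadMonomials m G) = initialIdeal m I

/-- `S` is a set of monomials that generates `I`, and no proper subset of `S` generates `I`. -/
def IsMinimalMonomialGenerators (I : Ideal (MvPolynomial σ k))
    (S : Set (MvPolynomial σ k)) : Prop :=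
  (∀ u ∈ S, ∃ d : σ →₀ ℕ, u = monomial d 1) ∧ Ideal.span S = I ∧
    ∀ T : Set (MvPolynomial σ k), T ⊂ S → Ideal.span T ≠ I

/-- The defining ideal of the monomial curve with exponents `a`: the kernel of the
`k`-algebra map `x_i ↦ t ^ (a i)`. -/
def monomialCurveIdeal (k : Type*) [Field k] (a : σ → ℕ) : Ideal (MvPolynomial σ k) :=
  RingHom.ker (aeval fun i => (Polynomial.X : Polynomial k) ^ a i)

end

/-! ### Backelin's curves

The variables `x₁, x₂, x₃, x₄` are `X 0, X 1, X 2, X 3`. For `2 ≤ n` and `3 * n + 2 ≤ r` none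
of the subtractions of natural numbers below is truncated. -/

section

variable (k : Type*) [Field k] (n r : ℕ)

/-- The smallest exponent `s = r (3 n + 2) + 3`. -/
def s (n r : ℕ) : ℕ := r * (3 * n + 2) + 3

/-- The Backelin ideal, the defining ideal of the curve
`(t ^ s, t ^ (s + 3), t ^ (s + 3 n + 1), t ^ (s + 3 n + 2))`. -/
def P : Ideal (MvPolynomial (Fin 4) k) :=
  monomialCurveIdeal k ![s n r, s n r + 3, s n r + 3 * n + 1, s n r + 3 * n + 2]

def f1 : MvPolynomial (Fin 4) k := X 1 * X 2 ^ 3 - X 0 * X 3 ^ 3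

def f2 (i : ℕ) : MvPolynomial (Fin 4) k :=
  X 0 ^ (n - i) * X 2 ^ (3 * i - 1) - X 1 ^ (n - i + 1) * X 3 ^ (3 * i - 2)

def f3 (j : ℕ) : MvPolynomial (Fin 4) k :=
  X 0 ^ (r - n + 3 + j) * X 1 ^ (n - 1 - j) - X 2 ^ (2 + 3 * j) * X 3 ^ (r - 1 - 3 * j)

def f4 (j : ℕ) : MvPolynomial (Fin 4) k :=
  X 0 ^ (r - 2 * n + 3 + j) * X 1 ^ (2 * n - j) - X 2 ^ (3 * j + 1) * X 3 ^ (r + 1 - 3 * j)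

def f5 : MvPolynomial (Fin 4) k :=
  X 0 ^ (r - n + 2) * X 1 ^ n * X 2 - X 3 ^ (r + 2)

def f6 : MvPolynomial (Fin 4) k := X 1 ^ (n + 1) * X 2 - X 0 ^ n * X 3 ^ 2

def f7 : MvPolynomial (Fin 4) k := X 1 ^ (2 * n + 1) - X 0 ^ (2 * n - 1) * X 2 * X 3

def g : MvPolynomial (Fin 4) k := X 0 ^ (r + 2) - X 1 * X 3 ^ r

/-- The set of binomial generators of the Backelin ideal. -/
def gens : Set (MvPolynomial (Fin 4) k) :=
  {f1 k, f5 k n r, f6 k n, f7 k n} ∪ {f | ∃ i, 1 ≤ i ∧ i ≤ n ∧ f = f2 k n i} ∪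
    {f | ∃ j, j ≤ n - 1 ∧ f = f3 k n r j} ∪ {f | ∃ j, j ≤ n - 1 ∧ f = f4 k n r j}

/-- The generators with `f3 (n - 1)` replaced by `g`. -/
def G : Set (MvPolynomial (Fin 4) k) := (gens k n r \ {f3 k n r (n - 1)}) ∪ {g k r}

/-- The list of minimal generators of the initial ideal. -/
def initialGens : Set (MvPolynomial (Fin 4) k) :=
  {X 1 * X 2 ^ 3, X 0 ^ (r - n + 2) * X 1 ^ n * X 2, X 1 ^ (n + 1) * X 2, X 1 ^ (2 * n + 1)} ∪
    {u | ∃ i, 1 ≤ i ∧ i ≤ n ∧ u = X 0 ^ (n - i) * X 2 ^ (3 * i - 1)} ∪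
    {u | ∃ j, j ≤ n - 1 ∧ u = X 0 ^ (r - n + 3 + j) * X 1 ^ (n - 1 - j)} ∪
    {u | ∃ j, j ≤ n - 1 ∧ u = X 0 ^ (r - 2 * n + 3 + j) * X 1 ^ (2 * n - j)}

end

end Backelin

end

noncomputable section

namespace Backelin

open MvPolynomial

/-! No S-polynomials are needed. Each element of `G` is a binomial in the curve ideal whose leading
exponent lies in `leadExps`, and every member of `leadExps` arises this way. It then suffices that
distinct standard monomials (those divisible by no monomial of `leadExps`) map to distinct powers of
`t`: a remainder of division by `G` lies in the ideal, its monomials cannot cancel, so it is zero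
(`isGroebnerBasis_of_forall_eq_zero`).

For the weights, let `N = s + 3n + 2` be the largest curve exponent. A monomial of total degree `T`
has weight `N * T - residue`, where `residue` does not involve `x₄`. On standard monomials `residue
< N` (`residue_lt`), so the weight determines `T` and the residue; the residue determines the first
three exponents (`residue_injective`), and `T` then gives the fourth.

The exponents in `leadExps` form an antichain with no `x₄`, which yields the claims on minimal
generators. -/

/-! ### Monomial ideals and division -/

section

variable {σ k : Type*} [Field k]

/-- A monomial ideal generated by an antichain of exponents has these as its only minimal
set of monomial generators. -/
theorem isMinimalMonomialGenerators_iff_of_antichain {E : Set (σ →₀ ℕ)}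
    (hE : IsAntichain (· ≤ ·) E) (S : Set (MvPolynomial σ k)) :
    IsMinimalMonomialGenerators
      (Ideal.span ((fun d => monomial d (1 : k)) '' E)) S ↔
      S = (fun d => monomial d (1 : k)) '' E := by
  -- Each `e ∈ E` is a multiple of some `d ∈ D`, itself a multiple of some `e' ∈ E`; the antichain
  -- condition collapses `e' ≤ d ≤ e` to equalities.
  have key : ∀ D : Set (σ →₀ ℕ), Ideal.span ((fun d => monomial d (1 : k)) '' D) =
      Ideal.span ((fun d => monomial d (1 : k)) '' E) → E ⊆ D := by
    intro D hD e he
    have h1 : monomial e (1 : k) ∈ Ideal.span ((fun d => monomial d (1 : k)) '' D) := by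
      rw [hD]
      exact Ideal.subset_span ⟨e, he, rfl⟩
    obtain ⟨d, hd, hde⟩ := mem_ideal_span_monomial_image.1 h1 e (by classical simp [coeff_monomial])
    have h2 : monomial d (1 : k) ∈ Ideal.span ((fun d => monomial d (1 : k)) '' E) := by
      rw [← hD]
      exact Ideal.subset_span ⟨d, hd, rfl⟩
    obtain ⟨e', he', hed⟩ := mem_ideal_span_monomial_image.1 h2 d (by classical simp [coeff_monomial])
    have : e' = e := hE.eq he' he (hed.trans hde)
    subst this
    rwa [le_antisymm hed hde]
  constructor
  · rintro ⟨hmon, hspan, hmin⟩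
    have hS : S = (fun d => monomial d (1 : k)) '' {d | monomial d (1 : k) ∈ S} := by
      ext u
      constructor
      · intro hu
        obtain ⟨d, rfl⟩ := hmon u hu
        exact ⟨d, hu, rfl⟩
      · rintro ⟨d, hd, rfl⟩
        exact hd
    have hsub : (fun d => monomial d (1 : k)) '' E ⊆ S := by
      rw [hS]
      exact Set.image_mono (key _ (by rw [← hS, hspan]))
    by_contra hne
    exact hmin _ (hsub.ssubset_of_ne (Ne.symm hne)) rfl
  · rintro rfl
    refine ⟨?_, rfl, ?_⟩
    · rintro _ ⟨d, -, rfl⟩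
      exact ⟨d, rfl⟩
    · intro T hT hspan
      obtain ⟨D, hD, rfl⟩ := Set.subset_image_iff.1 hT.subset
      exact hT.2 (Set.image_mono (key D hspan))

theorem aeval_X_pow_eq_sum [Fintype σ] (a : σ → ℕ) (h : MvPolynomial σ k) :
    aeval (fun i => (Polynomial.X : Polynomial k) ^ a i) h =
      ∑ d ∈ h.support, Polynomial.monomial (∑ i, a i * d i) (h.coeff d) := by
  rw [aeval_def, eval₂_eq']
  refine Finset.sum_congr rfl fun d _ => ?_
  simp only [← pow_mul, Finset.prod_pow_eq_pow_sum, ← Polynomial.C_mul_X_pow_eq_monomial]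
  rfl

/-- A polynomial in the ideal of a monomial curve vanishes if its monomials have
pairwise distinct weights. -/
theorem eq_zero_of_mem_monomialCurveIdeal [Fintype σ] {a : σ → ℕ} {h : MvPolynomial σ k}
    (hh : h ∈ monomialCurveIdeal k a)
    (hinj : Set.InjOn (fun d : σ →₀ ℕ => ∑ i, a i * d i) (h.support : Set (σ →₀ ℕ))) :
    h = 0 := by
  rw [monomialCurveIdeal, RingHom.mem_ker, aeval_X_pow_eq_sum] at hh
  ext d
  by_contra hd
  have hd' : d ∈ h.support := mem_support_iff.2 hd
  have := congrArg (fun p => Polynomial.coeff p (∑ i, a i * d i)) hh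
  simp only [Polynomial.finsetSum_coeff, Polynomial.coeff_monomial, Polynomial.coeff_zero] at this
  rw [Finset.sum_eq_single_of_mem d hd', if_pos rfl] at this
  · exact hd this
  · intro e he hne
    exact if_neg fun h => hne (hinj he hd' h)

theorem binomial_mem_monomialCurveIdeal [Fintype σ] {a : σ → ℕ} {u v : σ →₀ ℕ}
    (h : ∑ i, a i * u i = ∑ i, a i * v i) :
    monomial u (1 : k) - monomial v 1 ∈ monomialCurveIdeal k a := by
  classical
  rw [monomialCurveIdeal, RingHom.mem_ker, map_sub, aeval_X_pow_eq_sum, aeval_X_pow_eq_sum]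
  simp [support_monomial, h]

/-- If no nonzero element of `I` is supported on monomials avoiding the leading monomials of the
finite set `G ⊆ I`, then `G` is a Gröbner basis of `I`. -/
theorem isGroebnerBasis_of_forall_eq_zero (m : MonomialOrder σ) {G : Set (MvPolynomial σ k)}
    {I : Ideal (MvPolynomial σ k)} (hfin : G.Finite) (hG : G ⊆ (I : Set (MvPolynomial σ k)))
    (h0 : ∀ f ∈ G, f ≠ 0)
    (hI : ∀ h ∈ I, (∀ c ∈ h.support, ∀ f ∈ G, ¬ m.degree f ≤ c) → h = 0) :
    IsGroebnerBasis m G I := by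
  refine ⟨hfin, hG, le_antisymm ?_ ?_⟩
  · refine Ideal.span_mono ?_
    rintro _ ⟨f, hf, hf0, rfl⟩
    exact ⟨f, hG hf, hf0, rfl⟩
  · refine Ideal.span_le.2 ?_
    rintro _ ⟨h, hh, hne, rfl⟩
    obtain ⟨q, ρ, heq, hdeg, hρ⟩ := m.div_set (B := G)
      (fun b hb => (m.leadingCoeff_ne_zero_iff.2 (h0 b hb)).isUnit) h
    have hmem : Finsupp.linearCombination _ (fun b : G => (b : MvPolynomial σ k)) q ∈ I := by
      rw [Finsupp.linearCombination_apply]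
      exact Ideal.sum_mem _ fun b _ => I.mul_mem_left _ (hG b.2)
    have hρI : ρ ∈ I := by
      rw [← (Ideal.add_mem_iff_right I hmem), ← heq]
      exact hh
    have hρ0 : ρ = 0 := hI ρ hρI hρ
    have hc : h.coeff (m.degree h) ≠ 0 := m.coeff_degree_ne_zero_iff.2 hne
    have hsum : h = q.sum fun b c => c * (b : MvPolynomial σ k) := by
      conv_lhs => rw [heq, hρ0, add_zero, Finsupp.linearCombination_apply]
      rfl
    -- The leading monomial of `h` survives in some product `q b * b`. The degree bound of the
    -- division makes it the leading monomial there, hence a multiple of that of `b`.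
    obtain ⟨b, hb⟩ : ∃ b : G, (q b * (b : MvPolynomial σ k)).coeff (m.degree h) ≠ 0 := by
      by_contra! hall
      apply hc
      have := congrArg (coeff (m.degree h)) hsum
      rw [Finsupp.sum, coeff_sum] at this
      rw [this]
      exact Finset.sum_eq_zero fun b _ => hall b
    have hle := m.le_degree (mem_support_iff.2 hb)
    rw [mul_comm] at hle hb
    have hd : m.degree h = m.degree ((b : MvPolynomial σ k) * q b) :=
      m.toSyn.injective (le_antisymm hle (hdeg b))
    have hbq : (b : MvPolynomial σ k) * q b ≠ 0 := fun h => hb (by simp [h])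
    rw [m.degree_mul (left_ne_zero_of_mul hbq) (right_ne_zero_of_mul hbq)] at hd
    have : monomial (m.degree h) (1 : k) =
        monomial (m.degree (q b)) 1 * monomial (m.degree (b : MvPolynomial σ k)) 1 := by
      rw [monomial_mul, hd, add_comm, one_mul]
    rw [this]
    exact Ideal.mul_mem_left _ _ (Ideal.subset_span ⟨b, b.2, left_ne_zero_of_mul hbq, rfl⟩)

end

/-! ### Exponents and weights -/

/-- The exponent vector of `x₁ ^ a * x₂ ^ b * x₃ ^ c * x₄ ^ d`. -/
def expVec (a b c d : ℕ) : Fin 4 →₀ ℕ := Finsupp.equivFunOnFinite.symm ![a, b, c, d]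

@[simp] theorem expVec_zero (a b c d : ℕ) : expVec a b c d 0 = a := rfl
@[simp] theorem expVec_one (a b c d : ℕ) : expVec a b c d 1 = b := rfl
@[simp] theorem expVec_two (a b c d : ℕ) : expVec a b c d 2 = c := rfl
@[simp] theorem expVec_three (a b c d : ℕ) : expVec a b c d 3 = d := rfl

theorem ext_four {u v : Fin 4 →₀ ℕ} (h0 : u 0 = v 0) (h1 : u 1 = v 1) (h2 : u 2 = v 2)
    (h3 : u 3 = v 3) : u = v := by
  ext i
  fin_cases i <;> assumption

theorem monomial_expVec (k : Type*) [Field k] (a b c d : ℕ) :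
    monomial (expVec a b c d) (1 : k) = X 0 ^ a * X 1 ^ b * X 2 ^ c * X 3 ^ d := by
  rw [monomial_eq, map_one, one_mul, Finsupp.prod_fintype _ _ (by simp), Fin.prod_univ_four]
  simp

/-- The exponents of the curve. -/
def curveExponents (n r : ℕ) : Fin 4 → ℕ :=
  ![s n r, s n r + 3, s n r + 3 * n + 1, s n r + 3 * n + 2]

theorem sum_curveExponents (n r : ℕ) (u : Fin 4 →₀ ℕ) :
    ∑ i, curveExponents n r i * u i = s n r * u 0 + (s n r + 3) * u 1 +
      (s n r + 3 * n + 1) * u 2 + (s n r + 3 * n + 2) * u 3 := by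
  rw [Fin.sum_univ_four]
  rfl

/-! ### Leading exponents and standard monomials -/

/-- `(a, b, c)` is the exponent of one of the minimal generators of the initial ideal. -/
def IsLeadExp (n r a b c : ℕ) : Prop :=
  (a = 0 ∧ b = 1 ∧ c = 3) ∨ (a + n = r + 2 ∧ b = n ∧ c = 1) ∨ (a = 0 ∧ b = n + 1 ∧ c = 1) ∨
    (a = 0 ∧ b = 2 * n + 1 ∧ c = 0) ∨ (a < n ∧ b = 0 ∧ c + 3 * a + 1 = 3 * n) ∨
    (a + b = r + 2 ∧ b < n ∧ c = 0) ∨ (a + b = r + 3 ∧ n < b ∧ b ≤ 2 * n ∧ c = 0)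

/-- The exponent vectors of the minimal generators of the initial ideal. -/
def leadExps (n r : ℕ) : Set (Fin 4 →₀ ℕ) :=
  {u | IsLeadExp n r (u 0) (u 1) (u 2) ∧ u 3 = 0}

theorem leadExps_antichain {n r : ℕ} (hn : 2 ≤ n) (hr : 3 * n + 2 ≤ r) :
    IsAntichain (· ≤ ·) (leadExps n r) := by
  rintro u ⟨hu, hu3⟩ v ⟨hv, hv3⟩ hne hle
  have h0 := hle 0
  have h1 := hle 1
  have h2 := hle 2
  have : ¬ (u 0 = v 0 ∧ u 1 = v 1 ∧ u 2 = v 2) :=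
    fun h => hne (ext_four h.1 h.2.1 h.2.2 (hu3.trans hv3.symm))
  unfold IsLeadExp at hu hv
  omega

/-- The exponents `(a, b, c)` of the standard monomials not divisible by `x₄`. -/
structure IsStandard (n r a b c : ℕ) : Prop where
  le_two_mul : b ≤ 2 * n
  le_of_pos : 1 ≤ c → b ≤ n
  eq_zero : 3 ≤ c → b = 0
  lt_of_two_le : 2 ≤ c → a + (c + 1) / 3 < n
  add_le : b < n → a + b ≤ r + 1
  add_le_of_le : n ≤ b → a + b ≤ r + 2
  add_le_of_pos : 1 ≤ c → a + b ≤ r + 1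

theorem isStandard_of_not_le {n r : ℕ} (hn : 2 ≤ n) (hr : 3 * n + 2 ≤ r) {u : Fin 4 →₀ ℕ}
    (hu : ∀ v ∈ leadExps n r, ¬ v ≤ u) : IsStandard n r (u 0) (u 1) (u 2) := by
  have key : ∀ a b c, IsLeadExp n r a b c → ¬ (a ≤ u 0 ∧ b ≤ u 1 ∧ c ≤ u 2) := by
    rintro a b c h ⟨h0, h1, h2⟩
    refine hu (expVec a b c 0) ⟨h, rfl⟩ fun i => ?_
    fin_cases i
    exacts [h0, h1, h2, Nat.zero_le _]
  unfold IsLeadExp at key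
  generalize u 0 = a at key ⊢
  generalize u 1 = b at key ⊢
  generalize u 2 = c at key ⊢
  have k1 := key 0 1 3 (by omega)
  have k2 := key (r + 2 - n) n 1 (by omega)
  have k3 := key 0 (n + 1) 1 (by omega)
  have k4 := key 0 (2 * n + 1) 0 (by omega)
  have k5 := key 0 0 (3 * n - 1) (by omega)
  -- `i = (c + 1) / 3` is the largest `i` with `3 * i - 1 ≤ c`, so it gives the strongest bound
  -- among the exponents of the `f2` family.
  have k6 : ¬ (2 ≤ c ∧ (c + 1) / 3 ≤ n ∧ n ≤ a + (c + 1) / 3) := fun h =>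
    key (n - (c + 1) / 3) 0 (3 * ((c + 1) / 3) - 1) (by omega) (by omega)
  have k7 : ¬ (b < n ∧ r + 2 ≤ a + b) := fun h =>
    key (r + 2 - b) b 0 (by omega) (by omega)
  -- Covers `b = n`, which neither `k7` nor `k9` reaches.
  have k8 := key (r + 3 - n) (n - 1) 0 (by omega)
  have k9 : ¬ (n < b ∧ b ≤ 2 * n ∧ r + 3 ≤ a + b) := fun h =>
    key (r + 3 - b) b 0 (by omega) (by omega)
  constructor <;> omega

/-! ### Weights of standard monomials -/

/-- Minus the weight of a standard monomial modulo the largest curve exponent. -/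
def residue (n a b c : ℕ) : ℕ := (3 * n + 2) * a + (3 * n - 1) * b + c

theorem residue_eq {n a b c : ℕ} (hn : 2 ≤ n) :
    residue n a b c + 3 * b = (3 * n + 2) * (a + b) + c := by
  obtain ⟨p, rfl⟩ := Nat.exists_eq_add_of_le hn
  rw [residue, show 3 * (2 + p) - 1 = 3 * p + 5 by omega]
  ring

theorem residue_lt {n r a b c : ℕ} (hn : 2 ≤ n) (hr : 3 * n + 2 ≤ r)
    (h : IsStandard n r a b c) : residue n a b c < (3 * n + 2) * (r + 1) + 3 := by
  obtain ⟨h1, h2, h3, h4, h5, h6, h7⟩ := h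
  have e := residue_eq (a := a) (b := b) (c := c) hn
  rcases Nat.lt_or_ge (r + 1) (a + b) with hlt | hge
  · have hab : a + b = r + 2 := by omega
    rw [hab, show r + 2 = (r + 1) + 1 from rfl, Nat.mul_succ] at e
    omega
  · rcases Nat.lt_or_ge c 2 with hc | hc
    · have := Nat.mul_le_mul_left (3 * n + 2) hge
      omega
    · have hab : a + b ≤ r := by omega
      have := Nat.mul_le_mul_left (3 * n + 2) hab
      rw [Nat.mul_succ]
      omega

theorem residue_injective_aux {n r a b c a' b' c' : ℕ} (hn : 2 ≤ n)
    (h : IsStandard n r a b c) (h' : IsStandard n r a' b' c')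
    (he : residue n a b c = residue n a' b' c') (hle : a' + b' ≤ a + b) :
    a = a' ∧ b = b' ∧ c = c' := by
  have e := residue_eq (a := a) (b := b) (c := c) hn
  have e' := residue_eq (a := a') (b := b') (c := c') hn
  obtain ⟨h1, h2, h3, h4, -, -, -⟩ := h
  obtain ⟨h1', h2', h3', h4', -, -, -⟩ := h'
  obtain ⟨δ, hδ⟩ := Nat.exists_eq_add_of_le hle
  rw [hδ, Nat.mul_add] at e
  -- Subtracting `e'` from `e` gives `(3n + 2)δ = 3(b - b') + c' - c`, while `b ≤ 2n` and `c' < 3n`.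
  have hδ3 : δ < 3 := by
    by_contra hge
    have := Nat.mul_le_mul_left (3 * n + 2) (not_lt.1 hge)
    omega
  -- For `δ = 0`, `b ≠ b'` would make `c` and `c'` differ by at least 3, so the larger one is at
  -- least 3 and its monomial has no `x₂`, which has the wrong sign. For `δ = 1, 2` the equation
  -- forces `c'` to be too large for `a' + (c' + 1) / 3 < n`.
  interval_cases δ <;> omega

theorem residue_injective {n r a b c a' b' c' : ℕ} (hn : 2 ≤ n)
    (h : IsStandard n r a b c) (h' : IsStandard n r a' b' c')
    (he : residue n a b c = residue n a' b' c') : a = a' ∧ b = b' ∧ c = c' := by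
  rcases le_total (a' + b') (a + b) with hle | hle
  · exact residue_injective_aux hn h h' he hle
  · obtain ⟨rfl, rfl, rfl⟩ := residue_injective_aux hn h' h he.symm hle
    exact ⟨rfl, rfl, rfl⟩

/-- The coefficients `3n + 2`, `3n - 1`, `1`, `0` are the gaps between the largest curve exponent
and the four exponents. -/
theorem weight_add_residue {n : ℕ} (hn : 2 ≤ n) (r : ℕ) (u : Fin 4 →₀ ℕ) :
    ∑ i, curveExponents n r i * u i + residue n (u 0) (u 1) (u 2) =
      ((3 * n + 2) * (r + 1) + 3) * (u 0 + u 1 + u 2 + u 3) := by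
  obtain ⟨p, rfl⟩ := Nat.exists_eq_add_of_le hn
  rw [sum_curveExponents, residue, s, show 3 * (2 + p) - 1 = 3 * p + 5 by omega]
  ring

/-- Distinct standard monomials have distinct weights. -/
theorem weight_injective {n r : ℕ} (hn : 2 ≤ n) (hr : 3 * n + 2 ≤ r) {u v : Fin 4 →₀ ℕ}
    (hu : IsStandard n r (u 0) (u 1) (u 2)) (hv : IsStandard n r (v 0) (v 1) (v 2))
    (h : ∑ i, curveExponents n r i * u i = ∑ i, curveExponents n r i * v i) : u = v := by
  have eu := weight_add_residue hn r u
  have ev := weight_add_residue hn r v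
  have lu := residue_lt hn hr hu
  have lv := residue_lt hn hr hv
  have hT : u 0 + u 1 + u 2 + u 3 = v 0 + v 1 + v 2 + v 3 := by
    rcases lt_trichotomy (u 0 + u 1 + u 2 + u 3) (v 0 + v 1 + v 2 + v 3) with hlt | heq | hlt
    · have := Nat.mul_le_mul_left ((3 * n + 2) * (r + 1) + 3) (Nat.succ_le_of_lt hlt)
      rw [Nat.mul_succ] at this
      omega
    · exact heq
    · have := Nat.mul_le_mul_left ((3 * n + 2) * (r + 1) + 3) (Nat.succ_le_of_lt hlt)
      rw [Nat.mul_succ] at this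
      omega
  rw [hT] at eu
  obtain ⟨h0, h1, h2⟩ := residue_injective hn hu hv (by omega)
  exact ext_four h0 h1 h2 (by omega)

/-! ### The generators -/

/-- `f` is a binomial in the curve ideal with leading exponent `u`, one of the exponents in
`leadExps`. -/
def IsLeadBinomial {k : Type*} [Field k] (n r : ℕ) (f : MvPolynomial (Fin 4) k)
    (u : Fin 4 →₀ ℕ) : Prop :=
  u ∈ leadExps n r ∧ f ∈ P k n r ∧ f ≠ 0 ∧ (degRevLex 4).degree f = u

theorem isLeadBinomial_of_lt {k : Type*} [Field k] {n r : ℕ} {a b c a' b' c' d' : ℕ}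
    (hu : IsLeadExp n r a b c)
    (hw : s n r * a + (s n r + 3) * b + (s n r + 3 * n + 1) * c = s n r * a' + (s n r + 3) * b' +
      (s n r + 3 * n + 1) * c' + (s n r + 3 * n + 2) * d')
    (hlt : a' + b' + c' + d' < a + b + c ∨ (a' + b' + c' + d' = a + b + c ∧ 0 < d')) :
    IsLeadBinomial n r
      (X 0 ^ a * X 1 ^ b * X 2 ^ c - X 0 ^ a' * X 1 ^ b' * X 2 ^ c' * X 3 ^ d' :
        MvPolynomial (Fin 4) k) (expVec a b c 0) := by
  classical
  have hf : (X 0 ^ a * X 1 ^ b * X 2 ^ c - X 0 ^ a' * X 1 ^ b' * X 2 ^ c' * X 3 ^ d' :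
      MvPolynomial (Fin 4) k) =
      monomial (expVec a b c 0) 1 - monomial (expVec a' b' c' d') 1 := by
    rw [monomial_expVec, monomial_expVec, pow_zero, mul_one]
  have hlt' : (degRevLex 4).toSyn (expVec a' b' c' d') < (degRevLex 4).toSyn (expVec a b c 0) := by
    refine (DegRevLex.lt_iff _ _).2 ?_
    rw [Finsupp.degree_eq_sum, Finsupp.degree_eq_sum, Fin.sum_univ_four, Fin.sum_univ_four]
    -- In equal degrees `x₄` decides: it is the last variable and occurs only in the trailing
    -- monomial.
    refine hlt.imp id (And.imp id fun hd => ⟨3, fun j hj => ?_, hd⟩)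
    omega
  have hlt'' : (degRevLex 4).toSyn ((degRevLex 4).degree
      (monomial (expVec a' b' c' d') (1 : k))) < (degRevLex 4).toSyn ((degRevLex 4).degree
      (monomial (expVec a b c 0) (1 : k))) := by
    simpa [MonomialOrder.degree_monomial] using hlt'
  have hne : expVec a b c 0 ≠ expVec a' b' c' d' := fun h => by simp [h] at hlt'
  rw [hf]
  refine ⟨⟨hu, rfl⟩, binomial_mem_monomialCurveIdeal ?_, ?_, ?_⟩
  · have h1 := sum_curveExponents n r (expVec a b c 0)
    have h2 := sum_curveExponents n r (expVec a' b' c' d')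
    simp only [expVec_zero, expVec_one, expVec_two, expVec_three, mul_zero, add_zero] at h1 h2
    exact h1.trans (hw.trans h2.symm)
  · rw [sub_ne_zero]
    exact fun h => hne (monomial_left_injective one_ne_zero h)
  · rw [MonomialOrder.degree_sub_of_lt hlt'']
    simp [MonomialOrder.degree_monomial]

section

variable (k : Type*) [Field k] {n r : ℕ}

theorem isLeadBinomial_f1 : IsLeadBinomial n r (f1 k) (expVec 0 1 3 0) := by
  have := isLeadBinomial_of_lt (k := k) (n := n) (r := r) (a := 0) (b := 1) (c := 3) (a' := 1)
    (b' := 0) (c' := 0) (d' := 3) (by unfold IsLeadExp; omega) (by ring) (by omega)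
  simpa [f1] using this

theorem isLeadBinomial_f2 {i : ℕ} (h1 : 1 ≤ i) (hi : i ≤ n) :
    IsLeadBinomial n r (f2 k n i) (expVec (n - i) 0 (3 * i - 1) 0) := by
  have := isLeadBinomial_of_lt (k := k) (n := n) (r := r) (a := n - i) (b := 0)
    (c := 3 * i - 1) (a' := 0) (b' := n - i + 1) (c' := 0) (d' := 3 * i - 2)
    (by unfold IsLeadExp; omega) (by
      -- Writing the inequalities as sums removes the truncated subtractions, leaving a polynomial
      -- identity.
      obtain ⟨p, rfl⟩ := Nat.exists_eq_add_of_le hi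
      obtain ⟨q, rfl⟩ := Nat.exists_eq_add_of_le h1
      rw [show 1 + q + p - (1 + q) = p by omega, show 3 * (1 + q) - 1 = 3 * q + 2 by omega,
        show 3 * (1 + q) - 2 = 3 * q + 1 by omega]
      ring) (by omega)
  simpa [f2] using this

theorem isLeadBinomial_f3 (hr : 3 * n + 2 ≤ r) {j : ℕ} (hj : j < n) :
    IsLeadBinomial n r (f3 k n r j) (expVec (r - n + 3 + j) (n - 1 - j) 0 0) := by
  have := isLeadBinomial_of_lt (k := k) (n := n) (r := r) (a := r - n + 3 + j) (b := n - 1 - j)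
    (c := 0) (a' := 0) (b' := 0) (c' := 2 + 3 * j) (d' := r - 1 - 3 * j)
    (by unfold IsLeadExp; omega) (by
      obtain ⟨p, rfl⟩ := Nat.exists_eq_add_of_lt hj
      obtain ⟨q, rfl⟩ := Nat.exists_eq_add_of_le hr
      rw [show 3 * (j + p + 1) + 2 + q - (j + p + 1) + 3 + j = 3 * j + 2 * p + q + 7 by omega,
        show j + p + 1 - 1 - j = p by omega,
        show 3 * (j + p + 1) + 2 + q - 1 - 3 * j = 3 * p + q + 4 by omega, s]
      ring) (by omega)
  simpa [f3] using this

theorem isLeadBinomial_f4 (hr : 3 * n + 2 ≤ r) {j : ℕ} (hj : j < n) :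
    IsLeadBinomial n r (f4 k n r j) (expVec (r - 2 * n + 3 + j) (2 * n - j) 0 0) := by
  have := isLeadBinomial_of_lt (k := k) (n := n) (r := r) (a := r - 2 * n + 3 + j)
    (b := 2 * n - j) (c := 0) (a' := 0) (b' := 0) (c' := 3 * j + 1) (d' := r + 1 - 3 * j)
    (by unfold IsLeadExp; omega) (by
      obtain ⟨p, rfl⟩ := Nat.exists_eq_add_of_lt hj
      obtain ⟨q, rfl⟩ := Nat.exists_eq_add_of_le hr
      rw [show 3 * (j + p + 1) + 2 + q - 2 * (j + p + 1) + 3 + j = 2 * j + p + q + 6 by omega,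
        show 2 * (j + p + 1) - j = j + 2 * p + 2 by omega,
        show 3 * (j + p + 1) + 2 + q + 1 - 3 * j = 3 * p + q + 6 by omega, s]
      ring) (by omega)
  simpa [f4] using this

theorem isLeadBinomial_f5 (hr : 3 * n + 2 ≤ r) :
    IsLeadBinomial n r (f5 k n r) (expVec (r - n + 2) n 1 0) := by
  have := isLeadBinomial_of_lt (k := k) (n := n) (r := r) (a := r - n + 2)
    (b := n) (c := 1) (a' := 0) (b' := 0) (c' := 0) (d' := r + 2)
    (by unfold IsLeadExp; omega) (by
      obtain ⟨q, rfl⟩ := Nat.exists_eq_add_of_le hr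
      rw [show 3 * n + 2 + q - n + 2 = 2 * n + q + 4 by omega, s]
      ring) (by omega)
  simpa [f5] using this

theorem isLeadBinomial_f6 : IsLeadBinomial n r (f6 k n) (expVec 0 (n + 1) 1 0) := by
  have := isLeadBinomial_of_lt (k := k) (n := n) (r := r) (a := 0)
    (b := n + 1) (c := 1) (a' := n) (b' := 0) (c' := 0) (d' := 2)
    (by unfold IsLeadExp; omega) (by ring) (by omega)
  simpa [f6] using this

theorem isLeadBinomial_f7 (hn : 2 ≤ n) :
    IsLeadBinomial n r (f7 k n) (expVec 0 (2 * n + 1) 0 0) := by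
  have := isLeadBinomial_of_lt (k := k) (n := n) (r := r) (a := 0)
    (b := 2 * n + 1) (c := 0) (a' := 2 * n - 1) (b' := 0) (c' := 1) (d' := 1)
    (by unfold IsLeadExp; omega) (by
      obtain ⟨p, rfl⟩ := Nat.exists_eq_add_of_le hn
      rw [show 2 * (2 + p) - 1 = 2 * p + 3 by omega]
      ring) (by omega)
  simpa [f7] using this

theorem isLeadBinomial_g (hn : 2 ≤ n) :
    IsLeadBinomial n r (g k r) (expVec (r + 2) 0 0 0) := by
  have := isLeadBinomial_of_lt (k := k) (n := n) (r := r) (a := r + 2)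
    (b := 0) (c := 0) (a' := 0) (b' := 1) (c' := 0) (d' := r)
    (by unfold IsLeadExp; omega) (by rw [s]; ring) (by omega)
  simpa [g] using this

/-! ### Leading monomials of `G` and the Gröbner basis property -/

theorem exists_isLeadBinomial_of_mem_gens (hn : 2 ≤ n) (hr : 3 * n + 2 ≤ r)
    {f : MvPolynomial (Fin 4) k} (hf : f ∈ gens k n r) : ∃ u, IsLeadBinomial n r f u := by
  rcases hf with (((rfl | rfl | rfl | rfl) | ⟨i, h1, hi, rfl⟩) | ⟨j, hj, rfl⟩) | ⟨j, hj, rfl⟩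
  exacts [⟨_, isLeadBinomial_f1 k⟩, ⟨_, isLeadBinomial_f5 k hr⟩, ⟨_, isLeadBinomial_f6 k⟩,
    ⟨_, isLeadBinomial_f7 k hn⟩, ⟨_, isLeadBinomial_f2 k h1 hi⟩,
    ⟨_, isLeadBinomial_f3 k hr (by omega)⟩, ⟨_, isLeadBinomial_f4 k hr (by omega)⟩]

theorem exists_isLeadBinomial_of_mem_G (hn : 2 ≤ n) (hr : 3 * n + 2 ≤ r)
    {f : MvPolynomial (Fin 4) k} (hf : f ∈ G k n r) : ∃ u, IsLeadBinomial n r f u := by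
  rcases hf with ⟨hf, -⟩ | rfl
  · exact exists_isLeadBinomial_of_mem_gens k hn hr hf
  · exact ⟨_, isLeadBinomial_g k hn⟩

/-- The members of `leadExps`, parametrized as in the list of generators. -/
theorem mem_leadExps_iff (hn : 2 ≤ n) (hr : 3 * n + 2 ≤ r) (u : Fin 4 →₀ ℕ) :
    u ∈ leadExps n r ↔
      ((((u = expVec 0 1 3 0 ∨ u = expVec (r - n + 2) n 1 0 ∨ u = expVec 0 (n + 1) 1 0 ∨
        u = expVec 0 (2 * n + 1) 0 0) ∨
        ∃ i, 1 ≤ i ∧ i ≤ n ∧ u = expVec (n - i) 0 (3 * i - 1) 0) ∨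
        ∃ j, j ≤ n - 1 ∧ u = expVec (r - n + 3 + j) (n - 1 - j) 0 0) ∨
        ∃ j, j ≤ n - 1 ∧ u = expVec (r - 2 * n + 3 + j) (2 * n - j) 0 0) := by
  constructor
  · rintro ⟨hu, h3⟩
    have mk : ∀ a b c, u 0 = a → u 1 = b → u 2 = c → u = expVec a b c 0 :=
      fun a b c h0 h1 h2 => ext_four h0 h1 h2 h3
    rcases hu with ⟨h0, h1, h2⟩ | ⟨h0, h1, h2⟩ | ⟨h0, h1, h2⟩ | ⟨h0, h1, h2⟩ | ⟨h0, h1, h2⟩ |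
      ⟨h0, h1, h2⟩ | ⟨h0, h1, h2, h4⟩
    · exact .inl (.inl (.inl (.inl (mk _ _ _ h0 h1 h2))))
    · exact .inl (.inl (.inl (.inr (.inl (mk _ _ _ (by omega) h1 h2)))))
    · exact .inl (.inl (.inl (.inr (.inr (.inl (mk _ _ _ h0 h1 h2))))))
    · exact .inl (.inl (.inl (.inr (.inr (.inr (mk _ _ _ h0 h1 h2))))))
    · exact .inl (.inl (.inr ⟨n - u 0, by omega, by omega,
        mk _ _ _ (by omega) h1 (by omega)⟩))
    · exact .inl (.inr ⟨n - 1 - u 1, by omega, mk _ _ _ (by omega) (by omega) h2⟩)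
    · exact .inr ⟨2 * n - u 1, by omega, mk _ _ _ (by omega) (by omega) h4⟩
  · rintro ((((rfl | rfl | rfl | rfl) | ⟨i, h1, hi, rfl⟩) | ⟨j, hj, rfl⟩) | ⟨j, hj, rfl⟩) <;>
      refine ⟨?_, rfl⟩ <;>
      rw [expVec_zero, expVec_one, expVec_two] <;> unfold IsLeadExp <;> omega

theorem exists_mem_gens_of_mem_leadExps (hn : 2 ≤ n) (hr : 3 * n + 2 ≤ r) {u : Fin 4 →₀ ℕ}
    (hu : u ∈ leadExps n r) : ∃ f ∈ gens k n r, IsLeadBinomial n r f u := by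
  rcases (mem_leadExps_iff hn hr u).1 hu with
    (((rfl | rfl | rfl | rfl) | ⟨i, h1, hi, rfl⟩) | ⟨j, hj, rfl⟩) | ⟨j, hj, rfl⟩
  · exact ⟨_, .inl (.inl (.inl (.inl rfl))), isLeadBinomial_f1 k⟩
  · exact ⟨_, .inl (.inl (.inl (.inr (.inl rfl)))), isLeadBinomial_f5 k hr⟩
  · exact ⟨_, .inl (.inl (.inl (.inr (.inr (.inl rfl))))), isLeadBinomial_f6 k⟩
  · exact ⟨_, .inl (.inl (.inl (.inr (.inr (.inr rfl))))), isLeadBinomial_f7 k hn⟩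
  · exact ⟨_, .inl (.inl (.inr ⟨i, h1, hi, rfl⟩)), isLeadBinomial_f2 k h1 hi⟩
  · exact ⟨_, .inl (.inr ⟨j, hj, rfl⟩), isLeadBinomial_f3 k hr (by omega)⟩
  · exact ⟨_, .inr ⟨j, hj, rfl⟩, isLeadBinomial_f4 k hr (by omega)⟩

/-- Replacing `f3 (n - 1)` by `g` loses no leading exponent, since both have leading monomial `x₁ ^
(r + 2)`. -/
theorem exists_mem_G_of_mem_leadExps (hn : 2 ≤ n) (hr : 3 * n + 2 ≤ r) {u : Fin 4 →₀ ℕ}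
    (hu : u ∈ leadExps n r) : ∃ f ∈ G k n r, IsLeadBinomial n r f u := by
  obtain ⟨f, hf, hfu⟩ := exists_mem_gens_of_mem_leadExps k hn hr hu
  by_cases h : f = f3 k n r (n - 1)
  · have h3 := isLeadBinomial_f3 k hr (j := n - 1) (by omega)
    rw [show r - n + 3 + (n - 1) = r + 2 by omega, Nat.sub_self, ← h] at h3
    refine ⟨_, .inr rfl, ?_⟩
    rw [← hfu.2.2.2, h3.2.2.2]
    exact isLeadBinomial_g k hn
  · exact ⟨f, .inl ⟨hf, h⟩, hfu⟩

theorem leadMonomials_G (hn : 2 ≤ n) (hr : 3 * n + 2 ≤ r) :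
    leadMonomials (degRevLex 4) (G k n r) = (fun d => monomial d (1 : k)) '' leadExps n r := by
  ext u
  constructor
  · rintro ⟨f, hf, -, rfl⟩
    obtain ⟨u, hu, -, -, rfl⟩ := exists_isLeadBinomial_of_mem_G k hn hr hf
    exact ⟨_, hu, rfl⟩
  · rintro ⟨u, hu, rfl⟩
    obtain ⟨f, hf, -, -, h0, rfl⟩ := exists_mem_G_of_mem_leadExps k hn hr hu
    exact ⟨f, hf, h0, rfl⟩

theorem initialGens_eq_image (hn : 2 ≤ n) (hr : 3 * n + 2 ≤ r) :
    initialGens k n r = (fun d => monomial d (1 : k)) '' leadExps n r := by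
  have hm : ∀ a b c, monomial (expVec a b c 0) (1 : k) = X 0 ^ a * X 1 ^ b * X 2 ^ c := by
    intro a b c
    rw [monomial_expVec, pow_zero, mul_one]
  ext u
  constructor
  · rintro ((((rfl | rfl | rfl | rfl) | ⟨i, h1, hi, rfl⟩) | ⟨j, hj, rfl⟩) | ⟨j, hj, rfl⟩)
    · exact ⟨_, (mem_leadExps_iff hn hr _).2 (.inl (.inl (.inl (.inl rfl)))), by simp [hm]⟩
    · exact ⟨_, (mem_leadExps_iff hn hr _).2 (.inl (.inl (.inl (.inr (.inl rfl))))), by simp [hm]⟩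
    · exact ⟨_, (mem_leadExps_iff hn hr _).2 (.inl (.inl (.inl (.inr (.inr (.inl rfl)))))),
        by simp [hm]⟩
    · exact ⟨_, (mem_leadExps_iff hn hr _).2 (.inl (.inl (.inl (.inr (.inr (.inr rfl)))))),
        by simp [hm]⟩
    · exact ⟨_, (mem_leadExps_iff hn hr _).2 (.inl (.inl (.inr ⟨i, h1, hi, rfl⟩))), by simp [hm]⟩
    · exact ⟨_, (mem_leadExps_iff hn hr _).2 (.inl (.inr ⟨j, hj, rfl⟩)), by simp [hm]⟩
    · exact ⟨_, (mem_leadExps_iff hn hr _).2 (.inr ⟨j, hj, rfl⟩), by simp [hm]⟩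
  · rintro ⟨u, hu, rfl⟩
    rcases (mem_leadExps_iff hn hr u).1 hu with
      (((rfl | rfl | rfl | rfl) | ⟨i, h1, hi, rfl⟩) | ⟨j, hj, rfl⟩) | ⟨j, hj, rfl⟩
    · exact .inl (.inl (.inl (.inl (by simp [hm]))))
    · exact .inl (.inl (.inl (.inr (.inl (by simp [hm])))))
    · exact .inl (.inl (.inl (.inr (.inr (.inl (by simp [hm]))))))
    · exact .inl (.inl (.inl (.inr (.inr (.inr (by simp [hm]))))))
    · exact .inl (.inl (.inr ⟨i, h1, hi, by simp [hm]⟩))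
    · exact .inl (.inr ⟨j, hj, by simp [hm]⟩)
    · exact .inr ⟨j, hj, by simp [hm]⟩

theorem finite_G (n r : ℕ) : (G k n r).Finite := by
  have hfam : ∀ (F : ℕ → MvPolynomial (Fin 4) k) (p : ℕ → Prop) (b : ℕ), (∀ i, p i → i ≤ b) →
      {f | ∃ i, p i ∧ f = F i}.Finite := by
    intro F p b hb
    refine ((Set.finite_Iic b).image F).subset ?_
    rintro _ ⟨i, hi, rfl⟩
    exact ⟨i, hb i hi, rfl⟩
  have h2 := hfam (f2 k n) (fun i => 1 ≤ i ∧ i ≤ n) n fun i hi => hi.2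
  simp only [and_assoc] at h2
  refine (Set.Finite.subset (s := gens k n r) ?_ Set.sdiff_subset).union (Set.finite_singleton _)
  exact (((Set.toFinite _).union h2).union (hfam _ _ (n - 1) fun i hi => hi)).union
    (hfam _ _ (n - 1) fun i hi => hi)

theorem isGroebnerBasis_G (hn : 2 ≤ n) (hr : 3 * n + 2 ≤ r) :
    IsGroebnerBasis (degRevLex 4) (G k n r) (P k n r) := by
  refine isGroebnerBasis_of_forall_eq_zero _ (finite_G k n r) (fun f hf => ?_) (fun f hf => ?_)
    fun h hh hstd => ?_
  · obtain ⟨u, hu⟩ := exists_isLeadBinomial_of_mem_G k hn hr hf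
    exact hu.2.1
  · obtain ⟨u, hu⟩ := exists_isLeadBinomial_of_mem_G k hn hr hf
    exact hu.2.2.1
  · have hS : ∀ c ∈ h.support, IsStandard n r (c 0) (c 1) (c 2) := by
      refine fun c hc => isStandard_of_not_le hn hr fun v hv => ?_
      obtain ⟨f, hf, -, -, -, rfl⟩ := exists_mem_G_of_mem_leadExps k hn hr hv
      exact hstd c hc f hf
    exact eq_zero_of_mem_monomialCurveIdeal (a := curveExponents n r) hh
      fun u hu v hv huv => weight_injective hn hr (hS u hu) (hS v hv) huv

end

end Backelin

end

theorem mainTheorem5 {k : Type*} [Field k] (n r : ℕ) (hn : 2 ≤ n) (hr : 3 * n + 2 ≤ r) :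
    Backelin.IsGroebnerBasis (Backelin.degRevLex 4) (Backelin.G k n r) (Backelin.P k n r) ∧
    (∀ S : Set (MvPolynomial (Fin 4) k),
      Backelin.IsMinimalMonomialGenerators
        (Backelin.initialIdeal (Backelin.degRevLex 4) (Backelin.P k n r)) S ↔
      S = Backelin.initialGens k n r) ∧
    ∀ u ∈ Backelin.initialGens k n r, ¬ (MvPolynomial.X 3 : MvPolynomial (Fin 4) k) ∣ u := by
  have hG := Backelin.isGroebnerBasis_G k hn hr
  refine ⟨hG, fun S => ?_, fun u hu => ?_⟩
  · rw [← hG.2.2, Backelin.leadMonomials_G k hn hr, Backelin.initialGens_eq_image k hn hr]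
    exact Backelin.isMinimalMonomialGenerators_iff_of_antichain
      (Backelin.leadExps_antichain hn hr) S
  · rw [Backelin.initialGens_eq_image k hn hr] at hu
    obtain ⟨d, hd, rfl⟩ := hu
    rw [MvPolynomial.X_dvd_monomial]
    simpa using hd.2
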